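/- Let $k$ be a perfect field, let $X$ and $Y$ be normal projective varieties over $k$ (integral, normal, closed subschemes of some projective space over $k$), and let $f\colon X\to Y$ be a finite surjective morphism over $k$. **Definitions.** For a normal projective variety $V$ over $k$ let $\operatorname{Div}(V)$ be the group of Cartier divisors on $V$. A $\mathbb{Q}$-divisor (respectively $\mathbb{R}$-divisor) on $V$ is an element of $\operatorname{Div}(V)\otimes_{\mathbb Z}\mathbb{Q}$ (respectively $\operatorname{Div}(V)\otimes_{\mathbb Z}\mathbb{R}$). For a Cartier divisor $L$ on $V$ let $\operatorname{Bs}(L)$ be the set of common zeros of all global sections of $\mathcal{O}_V(L)$, and let $\mathbf{B}(L)=\bigl(\bigcap_{m\ge 1}\operatorname{Bs}(mL)\bigr)_{\mathrm{red}}$. The stable base locus of a $\mathbb{Q}$-divisor $D$ is $\mathbf{B}(D)=\mathbf{B}(bD)$, where $b\ge 1$ is any integer such that $bD$ is Cartier; it does not depend on $b$. For an $\mathbb{R}$-divisor $\Delta$ on $V$, choose an ample Cartier divisor $A$ and a representation $\Delta\sim_{\mathbb{R}}\sum_i t_iA_i$ with $t_i\in\mathbb{R}$ and $A_i$ very ample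 Cartier divisors, where $\sim_{\mathbb{R}}$ means that the difference is a real linear combination of principal Cartier divisors. The augmented base locus of $\Delta$ with respect to these choices is $$\mathbf{B}_+(\Delta)=\Bigl(\bigcap_{m\ge 1}\mathbf{B}\bigl(\textstyle\sum_i\lfloor mt_i\rfloor A_i-A\bigr)\Bigr)_{\mathrm{red}}.$$ For a closed subscheme $Z\subseteq Y$, $f^{-1}Z$ denotes the reduced scheme associated to the scheme-theoretic preimage of $Z$. **Theorem.** 1. For every $\mathbb{Q}$-divisor $D$ on $Y$ one has $\mathbf{B}(f^*D)=f^{-1}\mathbf{B}(D)$, as reduced closed subschemes of $X$. 2. For every $\mathbb{R}$-divisor $\Delta$ on $Y$ one has $\mathbf{B}_+(f^*\Delta)=f^{-1}\mathbf{B}_+(\Delta)$, as reduced closed subschemes of $X$, whatever choices are used to define $\mathbf{B}_+(\Delta)$ on $Y$ and $\mathbf{B}_+(f^*\Delta)$ on $X$. -/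

import Mathlib

open AlgebraicGeometry CategoryTheory TopologicalSpace
open scoped TensorProduct

universe u

noncomputable section

namespace BaseLoci

/-! ### Normal and projective varieties -/

/-- A scheme is normal if all its local rings are integrally closed domains. -/
class IsNormalScheme (X : Scheme.{u}) : Prop where
  isDomain_stalk : ∀ x : X, IsDomain (X.presheaf.stalk x)
  isIntegrallyClosed_stalk : ∀ x : X, IsIntegrallyClosed (X.presheaf.stalk x)

section ProjectiveSpace

variable (k : Type u) [Field k] (n : ℕ)

/-- The grading of `k[x₀, …, xₙ]` by degree. -/
abbrev polyGrading : ℕ → Submodule k (MvPolynomial (Fin (n + 1)) k) :=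
  MvPolynomial.homogeneousSubmodule (Fin (n + 1)) k

instance gradedAlgebraPolyGrading : GradedAlgebra (polyGrading k n) := MvPolynomial.gradedAlgebra

/-- Projective `n`-space over `k`, as `Proj k[x₀, …, xₙ]`. -/
abbrev projSpace : Scheme.{u} := Proj (polyGrading k n)

/-- The structure morphism of projective space. -/
def projSpaceToSpec : projSpace k n ⟶ Spec (CommRingCat.of k) :=
  Proj.toSpecZero (polyGrading k n) ≫
    Spec.map (CommRingCat.ofHom (algebraMap k (polyGrading k n 0)))

/-- The standard open `D₊(xⱼ)` of projective space. -/
abbrev stdOpen (j : Fin (n + 1)) : (projSpace k n).Opens :=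
  Proj.basicOpen (polyGrading k n) (MvPolynomial.X j)

/-- The regular function `xₗ / xⱼ` on `D₊(xⱼ)`. -/
def coordRatio (l j : Fin (n + 1)) : Γ(projSpace k n, stdOpen k n j) :=
  (Proj.awayToSection (polyGrading k n) (MvPolynomial.X j)).hom
    (HomogeneousLocalization.Away.mk (polyGrading k n) (d := 1)
      (MvPolynomial.isHomogeneous_X k j) 1 (MvPolynomial.X l)
      (MvPolynomial.isHomogeneous_X k l))

end ProjectiveSpace

/-- The `k`-scheme `X` with structure morphism `s` is projective: it has a closed `k`-immersion into
some projective space over `k`. In particular it is separated and of finite type over `k`. -/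
def IsProjectiveOver (k : Type u) [Field k] (X : Scheme.{u})
    (s : X ⟶ Spec (CommRingCat.of k)) : Prop :=
  ∃ (n : ℕ) (i : X ⟶ projSpace k n), IsClosedImmersion i ∧ i ≫ projSpaceToSpec k n = s

/-! ### Cartier divisors on an integral scheme -/

section Cartier

variable (X : Scheme.{u}) [IsIntegral X]

/-- The image of `𝒪_{X,x}ˣ` in the multiplicative group of the function field. -/
def localUnits (x : X) : Subgroup (X.functionField)ˣ :=
  (Units.map (algebraMap (X.presheaf.stalk x) X.functionField :
    X.presheaf.stalk x →* X.functionField)).range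

/-- The global sections of the quotient sheaf `𝒦ˣ / 𝒪ˣ`, where `𝒦` is the constant sheaf of
rational functions. The stalk of this sheaf at `x` is `K(X)ˣ / 𝒪_{X,x}ˣ`, and a section is a family
of germs that is locally induced by one rational function, a local equation. -/
def cartierSubgroup : Subgroup (∀ x : X, (X.functionField)ˣ ⧸ localUnits X x) where
  carrier := {D | ∀ x : X, ∃ U : X.Opens, x ∈ U ∧
    ∃ e : (X.functionField)ˣ, ∀ y ∈ U, D y = QuotientGroup.mk e}
  one_mem' x := ⟨⊤, trivial, 1, fun _ _ ↦ rfl⟩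
  mul_mem' {D D'} h h' x := by
    obtain ⟨U, hU, e, he⟩ := h x
    obtain ⟨U', hU', e', he'⟩ := h' x
    refine ⟨U ⊓ U', ⟨hU, hU'⟩, e * e', fun y hy ↦ ?_⟩
    rw [Pi.mul_apply, he y hy.1, he' y hy.2, QuotientGroup.mk_mul]
  inv_mem' {D} h x := by
    obtain ⟨U, hU, e, he⟩ := h x
    exact ⟨U, hU, e⁻¹, fun y hy ↦ by rw [Pi.inv_apply, he y hy, QuotientGroup.mk_inv]⟩

/-- The group `Div(X)` of Cartier divisors, written additively. -/
abbrev CartierDivisor : Type u := Additive (cartierSubgroup X)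

instance addCommGroupCartierDivisor : AddCommGroup (CartierDivisor X) := inferInstance

variable {X}

/-- The germ of a Cartier divisor at a point. -/
def germAt (D : CartierDivisor X) (x : X) : (X.functionField)ˣ ⧸ localUnits X x :=
  D.toMul.1 x

/-- The principal Cartier divisor of a nonzero rational function. -/
def principal (g : (X.functionField)ˣ) : CartierDivisor X :=
  Additive.ofMul ⟨fun _ ↦ QuotientGroup.mk g, fun _ ↦ ⟨⊤, trivial, g, fun _ _ ↦ rfl⟩⟩

/-- The rational function `g` is a section of `𝒪_X(D)` near `x`: for a local equation `e` of `D`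
at `x`, the product `e * g` is regular at `x`. -/
def IsSectionAt (D : CartierDivisor X) (g : X.functionField) (x : X) : Prop :=
  ∃ (e : (X.functionField)ˣ) (a : X.presheaf.stalk x), QuotientGroup.mk e = germAt D x ∧
    algebraMap (X.presheaf.stalk x) X.functionField a = e * g

/-- The rational function `g` is a section of `𝒪_X(D)` near `x` that does not vanish at `x`: for
a local equation `e` of `D` at `x`, the product `e * g` is a unit of the local ring at `x`. -/
def IsNonvanishingAt (D : CartierDivisor X) (g : X.functionField) (x : X) : Prop :=
  ∃ (e : (X.functionField)ˣ) (a : X.presheaf.stalk x), QuotientGroup.mk e = germAt D x ∧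
    IsUnit a ∧ algebraMap (X.presheaf.stalk x) X.functionField a = e * g

/-- `H⁰(X, 𝒪_X(D))`, as a set of rational functions. -/
def globalSections (D : CartierDivisor X) : Set X.functionField :=
  {g | ∀ x : X, IsSectionAt D g x}

theorem isNonvanishingAt_iff (D : CartierDivisor X) (g : X.functionField) (x : X)
    (e : (X.functionField)ˣ) (he : QuotientGroup.mk e = germAt D x) :
    IsNonvanishingAt D g x ↔ ∃ a : X.presheaf.stalk x, IsUnit a ∧
      algebraMap (X.presheaf.stalk x) X.functionField a = e * g := by
  constructor
  · rintro ⟨e', a, he', ha, hag⟩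
    obtain ⟨c, hc⟩ := QuotientGroup.eq.mp (he'.trans he.symm)
    refine ⟨c * a, c.isUnit.mul ha, ?_⟩
    have hc' : algebraMap (X.presheaf.stalk x) X.functionField c = (e' : X.functionField)⁻¹ * e := by
      simpa using congrArg Units.val hc
    rw [map_mul, hc', hag]
    field_simp
  · rintro ⟨a, ha, hag⟩
    exact ⟨e, a, he, ha, hag⟩

theorem isOpen_setOf_isNonvanishingAt (D : CartierDivisor X) (g : X.functionField) :
    IsOpen {x : X | IsNonvanishingAt D g x} := by
  rw [isOpen_iff_forall_mem_open]
  intro x hx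
  obtain ⟨U, hxU, e, he⟩ := D.toMul.2 x
  obtain ⟨a, ha, hag⟩ := (isNonvanishingAt_iff D g x e (he x hxU).symm).mp hx
  obtain ⟨V, hxV, b, rfl⟩ := X.presheaf.exists_germ_eq a
  have hxb : x ∈ X.basicOpen b := (X.mem_basicOpen b x hxV).mpr ha
  refine ⟨(U ⊓ X.basicOpen b : X.Opens), ?_, (U ⊓ X.basicOpen b).2, ⟨hxU, hxb⟩⟩
  rintro y ⟨hyU, hyb⟩
  have hyV : y ∈ V := X.basicOpen_le b hyb
  refine (isNonvanishingAt_iff D g y e (he y hyU).symm).mpr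
    ⟨X.presheaf.germ V y hyV b, (X.mem_basicOpen b y hyV).mp hyb, ?_⟩
  have : Nonempty V := ⟨⟨x, hxV⟩⟩
  rw [← hag, Scheme.algebraMap_germ_eq_germToFunctionField,
    Scheme.algebraMap_germ_eq_germToFunctionField]

/-- The open set `X_g` where the section `g` of `𝒪_X(D)` does not vanish. -/
def nonvanishingLocus (D : CartierDivisor X) (g : X.functionField) : X.Opens :=
  ⟨{x | IsNonvanishingAt D g x}, isOpen_setOf_isNonvanishingAt D g⟩

/-- A Cartier divisor `A` on a quasi-compact integral scheme is ample if every point lies in an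
affine open set `X_g`, where `g` is a global section of some `𝒪_X(nA)` with `n ≥ 1`. -/
def IsAmple (A : CartierDivisor X) : Prop :=
  CompactSpace X ∧ ∀ x : X, ∃ n : ℕ, 0 < n ∧ ∃ g ∈ globalSections (n • A),
    x ∈ nonvanishingLocus (n • A) g ∧ IsAffineOpen (nonvanishingLocus (n • A) g)

/-- A Cartier divisor `A` on `X` is very ample over `k` if there is a `k`-immersion `i` of `X` into
some projective space with `i^* 𝒪(1) ≅ 𝒪_X(A)`. Such an isomorphism is the same thing as the
sections `g j` of `𝒪_X(A)` that correspond to the `i^* xⱼ`: the section `g j` generates `𝒪_X(A)`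
exactly over the preimage of `D₊(xⱼ)`, and there `g l / g j` is the pullback of `xₗ / xⱼ`. -/
def IsVeryAmple (k : Type u) [Field k] (s : X ⟶ Spec (CommRingCat.of k))
    (A : CartierDivisor X) : Prop :=
  ∃ (n : ℕ) (i : X ⟶ projSpace k n), IsImmersion i ∧ i ≫ projSpaceToSpec k n = s ∧
    ∃ g : Fin (n + 1) → X.functionField,
      (∀ j, g j ∈ globalSections A) ∧
      (∀ j, nonvanishingLocus A (g j) = i ⁻¹ᵁ stdOpen k n j) ∧
      ∀ (l j : Fin (n + 1)) (x : X) (hx : x ∈ i ⁻¹ᵁ stdOpen k n j),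
        g l = algebraMap (X.presheaf.stalk x) X.functionField
          (X.presheaf.germ (i ⁻¹ᵁ stdOpen k n j) x hx
            ((i.app (stdOpen k n j)).hom (coordRatio k n l j))) * g j

/-! ### Base loci -/

/-- The base locus of the complete linear system `|L|`, as a closed set: the common zeros of all
global sections of `𝒪_X(L)` (all of `X` if there is no nonzero section). -/
def baseLocus (L : CartierDivisor X) : Closeds X :=
  ⟨{x | ∀ g ∈ globalSections L, ¬ IsNonvanishingAt L g x}, by
    have h : {x : X | ∀ g ∈ globalSections L, ¬ IsNonvanishingAt L g x} =
        ⋂ g ∈ globalSections L, {x | IsNonvanishingAt L g x}ᶜ := by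
      ext x
      simp
    rw [h]
    exact isClosed_biInter fun g _ ↦ (isOpen_setOf_isNonvanishingAt L g).isClosed_compl⟩

/-- The closed set underlying the stable base locus of a Cartier divisor. -/
def stableBaseSet (L : CartierDivisor X) : Closeds X :=
  ⨅ (m : ℕ) (_ : 0 < m), baseLocus (m • L)

variable (X) in
/-- `Div(X) ⊗ ℚ`. -/
abbrev QDivisor : Type u := ℚ ⊗[ℤ] CartierDivisor X

variable (X) in
/-- `Div(X) ⊗ ℝ`. -/
abbrev RDivisor : Type u := ℝ ⊗[ℤ] CartierDivisor X

/-- The closed set underlying the stable base locus of a `ℚ`-divisor `D`. It equals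
`stableBaseSet L` for each Cartier divisor `L = bD` with `b ≥ 1`, see `stableBaseSetQ_eq`. -/
def stableBaseSetQ (D : QDivisor X) : Closeds X :=
  ⨅ (b : ℕ) (_ : 0 < b) (L : CartierDivisor X) (_ : b • D = 1 ⊗ₜ[ℤ] L), stableBaseSet L

theorem mk_eq_germAt_nsmul {L : CartierDivisor X} {x : X} {e : (X.functionField)ˣ}
    (he : QuotientGroup.mk e = germAt L x) (n : ℕ) :
    QuotientGroup.mk (e ^ n) = germAt (n • L) x := by
  rw [QuotientGroup.mk_pow, he]
  rfl

theorem baseLocus_nsmul_le (L : CartierDivisor X) (n : ℕ) :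
    baseLocus (n • L) ≤ baseLocus L := by
  rintro x hx g hg ⟨e, a, he, ha, hag⟩
  refine hx (g ^ n) (fun y ↦ ?_) ⟨e ^ n, a ^ n, mk_eq_germAt_nsmul he n, ha.pow n, ?_⟩
  · obtain ⟨e', a', he', hag'⟩ := hg y
    refine ⟨e' ^ n, a' ^ n, mk_eq_germAt_nsmul he' n, ?_⟩
    rw [map_pow, hag', mul_pow, Units.val_pow_eq_pow_val]
  · rw [map_pow, hag, mul_pow, Units.val_pow_eq_pow_val]

theorem stableBaseSet_nsmul (L : CartierDivisor X) {n : ℕ} (hn : 0 < n) :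
    stableBaseSet (n • L) = stableBaseSet L := by
  refine le_antisymm (le_iInf₂ fun m hm ↦ ?_) (le_iInf₂ fun m hm ↦ ?_)
  · refine (iInf₂_le m hm).trans ?_
    rw [smul_comm]
    exact baseLocus_nsmul_le _ n
  · rw [smul_smul]
    exact iInf₂_le (m * n) (Nat.mul_pos hm hn)

theorem stableBaseSetQ_eq {D : QDivisor X} {b : ℕ} (hb : 0 < b) {L : CartierDivisor X}
    (h : b • D = 1 ⊗ₜ[ℤ] L) : stableBaseSetQ D = stableBaseSet L := by
  refine le_antisymm (iInf₂_le_of_le b hb (iInf₂_le L h)) ?_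
  refine le_iInf₂ fun b' hb' ↦ le_iInf₂ fun L' h' ↦ ?_
  have key : (1 : ℚ) ⊗ₜ[ℤ] (b' • L) = (1 : ℚ) ⊗ₜ[ℤ] (b • L') := by
    rw [TensorProduct.tmul_smul, TensorProduct.tmul_smul, ← h, ← h', smul_comm]
  obtain ⟨c, hc⟩ := (IsLocalizedModule.eq_iff_exists (nonZeroDivisors ℤ)
    (TensorProduct.mk ℤ ℚ (CartierDivisor X) 1)).mp key
  have hc0 : (c : ℤ) ≠ 0 := nonZeroDivisors.ne_zero c.2
  have hn : 0 < (c : ℤ).natAbs := Int.natAbs_pos.mpr hc0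
  have hc' : (c : ℤ).natAbs • b' • L = (c : ℤ).natAbs • b • L' := by
    have hc1 : (c : ℤ) • b' • L = (c : ℤ) • b • L' := hc
    rcases Int.natAbs_eq (c : ℤ) with h1 | h1 <;> rw [h1] at hc1
    · simpa only [natCast_zsmul] using hc1
    · simpa only [neg_smul, natCast_zsmul, neg_inj] using hc1
  rw [← stableBaseSet_nsmul L hb', ← stableBaseSet_nsmul (b' • L) hn, hc',
    stableBaseSet_nsmul _ hn, stableBaseSet_nsmul _ hb]

/-- The stable base locus `𝐁(D)` of a `ℚ`-divisor, as a reduced closed subscheme (given by its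
ideal sheaf). -/
def stableBaseLocus (D : QDivisor X) : X.IdealSheafData :=
  Scheme.IdealSheafData.vanishingIdeal (stableBaseSetQ D)

/-- `ℝ`-linear equivalence: the difference is a real linear combination of principal Cartier
divisors. -/
def RLinearEquiv (Δ₁ Δ₂ : RDivisor X) : Prop :=
  Δ₁ - Δ₂ ∈ Submodule.span ℝ
    (Set.range fun g : (X.functionField)ˣ ↦ (1 : ℝ) ⊗ₜ[ℤ] principal g)

/-- The choices in the definition of the augmented base locus of an `ℝ`-divisor `Δ`: an ample
Cartier divisor `A` and a representation `Δ ∼_ℝ ∑ tᵢ Aᵢ` with real `tᵢ` and very ample Cartier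
divisors `Aᵢ`. -/
structure AugmentedChoice (k : Type u) [Field k] (s : X ⟶ Spec (CommRingCat.of k))
    (Δ : RDivisor X) where
  /-- the ample divisor -/
  A : CartierDivisor X
  isAmple : IsAmple A
  /-- the number of terms of the representation -/
  r : ℕ
  /-- the coefficients -/
  t : Fin r → ℝ
  /-- the very ample divisors -/
  B : Fin r → CartierDivisor X
  isVeryAmple : ∀ i, IsVeryAmple k s (B i)
  equiv : RLinearEquiv Δ (∑ i, t i ⊗ₜ[ℤ] B i)

/-- The augmented base locus `𝐁₊(Δ) = (⋂_{m ≥ 1} 𝐁(∑ ⌊m tᵢ⌋ Aᵢ - A))_red`, computed with the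
given choices, as a reduced closed subscheme (given by its ideal sheaf). -/
def augmentedBaseLocus {k : Type u} [Field k] {s : X ⟶ Spec (CommRingCat.of k)}
    {Δ : RDivisor X} (c : AugmentedChoice k s Δ) : X.IdealSheafData :=
  Scheme.IdealSheafData.vanishingIdeal
    (⨅ (m : ℕ) (_ : 0 < m), stableBaseSet ((∑ i, ⌊(m : ℝ) * c.t i⌋ • c.B i) - c.A))

end Cartier

/-! ### Pullback -/

section Pullback

variable {X Y : Scheme.{u}} [IsIntegral X] [IsIntegral Y] (f : X ⟶ Y) [IsDominant f]

theorem specializes_genericPoint : f (genericPoint X) ⤳ genericPoint Y := by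
  have h := (genericPoint_spec X).image f.continuous
  rw [Set.image_univ, f.denseRange.closure_range] at h
  exact h.specializes trivial

/-- The inclusion of function fields induced by a dominant morphism. -/
def functionFieldMap : Y.functionField →+* X.functionField :=
  (Y.presheaf.stalkSpecializes (specializes_genericPoint f) ≫ f.stalkMap (genericPoint X)).hom

theorem functionFieldMap_algebraMap (x : X) (a : Y.presheaf.stalk (f x)) :
    functionFieldMap f (algebraMap (Y.presheaf.stalk (f x)) Y.functionField a) =
      algebraMap (X.presheaf.stalk x) X.functionField ((f.stalkMap x).hom a) := by
  have h := Scheme.Hom.stalkSpecializes_stalkMap f (genericPoint X) x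
    ((genericPoint_spec X).specializes trivial)
  have h' := Y.presheaf.stalkSpecializes_comp (specializes_genericPoint f)
    ((genericPoint_spec Y).specializes (Set.mem_univ (f x)))
  have h'' := DFunLike.congr_fun (CommRingCat.hom_ext_iff.mp h) a
  rw [← h'] at h''
  exact h''

theorem localUnits_le_comap (x : X) :
    localUnits Y (f x) ≤ (localUnits X x).comap
      (Units.map (functionFieldMap f : Y.functionField →* X.functionField)) := by
  rintro _ ⟨c, rfl⟩
  refine ⟨Units.map ((f.stalkMap x).hom : Y.presheaf.stalk (f x) →* X.presheaf.stalk x) c, ?_⟩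
  ext
  exact (functionFieldMap_algebraMap f x c).symm

/-- The map on germs of Cartier divisors: a local equation at `f x` is pulled back to a local
equation at `x`. -/
def pullbackGerm (x : X) :
    (Y.functionField)ˣ ⧸ localUnits Y (f x) →* (X.functionField)ˣ ⧸ localUnits X x :=
  QuotientGroup.map _ _ (Units.map (functionFieldMap f : Y.functionField →* X.functionField))
    (localUnits_le_comap f x)

/-- The pullback `f^*` of Cartier divisors along a dominant morphism. -/
def pullbackCartier : CartierDivisor Y →+ CartierDivisor X :=
  MonoidHom.toAdditive
    { toFun := fun D ↦ ⟨fun x ↦ pullbackGerm f x (D.1 (f x)), fun x ↦ by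
        obtain ⟨U, hU, e, he⟩ := D.2 (f x)
        refine ⟨f ⁻¹ᵁ U, hU,
          Units.map (functionFieldMap f : Y.functionField →* X.functionField) e, fun y hy ↦ ?_⟩
        exact congrArg (pullbackGerm f y) (he (f y) hy)⟩
      map_one' := Subtype.ext (funext fun x ↦ map_one (pullbackGerm f x))
      map_mul' := fun D D' ↦ Subtype.ext (funext fun x ↦ map_mul (pullbackGerm f x) _ _) }

/-- The pullback of `ℚ`-divisors. -/
def pullbackQ : QDivisor Y →ₗ[ℚ] QDivisor X :=
  (pullbackCartier f).toIntLinearMap.baseChange ℚ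

/-- The pullback of `ℝ`-divisors. -/
def pullbackR : RDivisor Y →ₗ[ℝ] RDivisor X :=
  (pullbackCartier f).toIntLinearMap.baseChange ℝ

/-- The reduced scheme associated to the scheme-theoretic preimage of a closed subscheme. -/
def reducedPreimage {X Y : Scheme.{u}} (f : X ⟶ Y) (Z : Y.IdealSheafData) : X.IdealSheafData :=
  (Z.comap f).radical

end Pullback

end BaseLoci

end

noncomputable section

namespace BaseLoci

/-! Both equalities are checked point by point on `X`. Sections pull back, and since stalk maps are
local, a section of `D` is nonzero at `f x` exactly when its pullback is nonzero at `x`. This gives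
one inclusion of the first part.

For the other, let `g` be a section of `f^*D` that does not vanish at `x`, with minimal polynomial
`∑ cᵢ Tⁱ` of degree `n` over `K(Y)`. If `e` is a local equation of `D` at `y`, then `e g` is
integral over the integrally closed ring `𝒪_{Y,y}`, so every `e^(n-i) cᵢ` lies in that ring: `cᵢ` is
a global section of `(n-i)D`. At `y = f x` the unit `e g` of `𝒪_{X,x}` is a root of a monic
polynomial over `𝒪_{Y,y}`, whose lower coefficients therefore cannot all be non-units. Hence some
`cᵢ` with `i < n` does not vanish at `f x` (`notMem_stableBaseSet_of_notMem_baseLocus_pullback`).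

For the second part, pulling back the choices on `Y` gives an ample divisor on `X` and divisors that
may fail to be very ample but have empty stable base locus. It thus suffices that `𝐁₊` is
independent of choices in this wider class (`exists_notMem_stableBaseSet_floor`). The difference
between one rounded divisor and a multiple of another is `ℝ`-equivalent to a nonnegative real
combination of divisors semiample at `x`, meaning that `x` avoids their stable base loci. A
`ℚ`-linear map `ℝ → ℚ` that fixes `1` and preserves the positivity of the finitely many coefficients
makes this relation rational. -/

/-! ### Rational approximation of a real cone -/

/-- Finitely many positive reals stay positive under a suitable `ℚ`-linear retraction `ℝ → ℚ`. -/
theorem exists_linearMap_rat_pos (S : Finset ℝ) :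
    ∃ φ : ℝ →ₗ[ℚ] ℚ, φ 1 = 1 ∧ ∀ s ∈ S, 0 < s → 0 < φ s := by
  let b := Module.Basis.ofVectorSpace ℚ ℝ
  -- Including `1` makes `ψ 1` positive, so that `ψ` can be normalized at the end.
  let T : Finset ℝ := insert 1 S
  -- `ev w v` is the value at `w` of the `ℚ`-linear map `b i ↦ v i`. It involves finitely many
  -- coordinates of `v`, so positivity is an open condition. The family `v = b` satisfies it, hence
  -- so does some rational family.
  let ev (w : ℝ) (v : Module.Basis.ofVectorSpaceIndex ℚ ℝ → ℝ) : ℝ :=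
    ∑ i ∈ (b.repr w).support, (b.repr w i : ℝ) * v i
  have hopen : IsOpen (⋂ w ∈ T.filter (0 < ·), {v | 0 < ev w v}) :=
    isOpen_biInter_finset fun w _ ↦ isOpen_lt continuous_const (by fun_prop)
  have hb (w : ℝ) : ev w (fun i ↦ b i) = w := by
    conv_rhs => rw [← b.linearCombination_repr w]
    simp [ev, Finsupp.linearCombination_apply, Finsupp.sum, Rat.smul_def]
  have hne : (⋂ w ∈ T.filter (0 < ·), {v | 0 < ev w v}).Nonempty :=
    ⟨fun i ↦ b i, Set.mem_iInter₂.mpr fun w hw ↦ by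
      simpa [hb] using (Finset.mem_filter.mp hw).2⟩
  obtain ⟨v, hv⟩ := (DenseRange.piMap (fun _ : Module.Basis.ofVectorSpaceIndex ℚ ℝ ↦
    Rat.denseRange_cast (𝕜 := ℝ))).exists_mem_open hopen hne
  let ψ : ℝ →ₗ[ℚ] ℚ := b.constr ℚ v
  have hψ : ∀ w ∈ T, 0 < w → 0 < ψ w := by
    intro w hw hw0
    have h := Set.mem_iInter₂.mp hv w (Finset.mem_filter.mpr ⟨hw, hw0⟩)
    have h' : ev w (Pi.map (fun _ ↦ Rat.cast) v) = (ψ w : ℚ) := by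
      simp [ev, ψ, Module.Basis.constr_apply, Finsupp.sum]
    rw [Set.mem_ofPred_eq, h'] at h
    exact_mod_cast h
  have h1 : 0 < ψ 1 := hψ 1 (Finset.mem_insert_self _ _) one_pos
  refine ⟨(ψ 1)⁻¹ • ψ, by simp [h1.ne'], fun s hs hs0 ↦ ?_⟩
  exact mul_pos (inv_pos.mpr h1) (hψ s (Finset.mem_insert_of_mem hs) hs0)

/-! ### Sections of divisors -/

section Sections

variable {X : Scheme.{u}} [IsIntegral X]

variable (X) in
/-- The rational functions that are regular at `x`. -/
def regularAt (x : X) : Subring X.functionField :=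
  (algebraMap (X.presheaf.stalk x) X.functionField).range

theorem germToFunctionField_mem_regularAt {U : X.Opens} [Nonempty U] {x : X} (hx : x ∈ U)
    (a : Γ(X, U)) : X.germToFunctionField U a ∈ regularAt X x :=
  ⟨X.presheaf.germ U x hx a, Scheme.algebraMap_germ_eq_germToFunctionField X hx a⟩

/-- The stalk is the localization of `Γ(X, U)` at `p`, so `h` has a denominator outside `p`. -/
theorem exists_mul_mem_of_mem_regularAt {U : X.Opens} [Nonempty U] (hU : IsAffineOpen U)
    (p : PrimeSpectrum Γ(X, U)) {h : X.functionField} (hp : h ∈ regularAt X (hU.fromSpec p)) :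
    ∃ d ∉ p.asIdeal, ∃ a : Γ(X, U),
      X.germToFunctionField U a = X.germToFunctionField U d * h := by
  have hxU : hU.fromSpec p ∈ U := by
    rw [← SetLike.mem_coe, ← hU.range_fromSpec]
    exact Set.mem_range_self p
  obtain ⟨c, rfl⟩ := hp
  let : Algebra Γ(X, U) (X.presheaf.stalk (hU.fromSpec p)) :=
    (X.presheaf.germ U _ hxU).hom.toAlgebra
  have hloc : IsLocalization.AtPrime (X.presheaf.stalk (hU.fromSpec p)) p.asIdeal :=
    hU.isLocalization_stalk' p hxU
  obtain ⟨⟨a, d⟩, had⟩ := IsLocalization.surj p.asIdeal.primeCompl c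
  refine ⟨d, d.2, a, ?_⟩
  have h2 := congrArg (algebraMap (X.presheaf.stalk (hU.fromSpec p)) X.functionField) had
  rw [map_mul] at h2
  have key (t : Γ(X, U)) : algebraMap (X.presheaf.stalk (hU.fromSpec p)) X.functionField
      (algebraMap Γ(X, U) _ t) = X.germToFunctionField U t :=
    Scheme.algebraMap_germ_eq_germToFunctionField X hxU t
  rw [key, key] at h2
  rw [← h2, mul_comm]

/-- A rational function that is regular on the basic open set `D(s)` of an affine open set `U`
becomes regular on `U` after multiplication with a power of `s`. -/
theorem exists_pow_mul_eq_germToFunctionField {U : X.Opens} [Nonempty U] (hU : IsAffineOpen U)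
    (s : Γ(X, U)) (h : X.functionField) (hh : ∀ x ∈ X.basicOpen s, h ∈ regularAt X x) :
    ∃ (N : ℕ) (a : Γ(X, U)),
      X.germToFunctionField U a = X.germToFunctionField U s ^ N * h := by
  let φ : Γ(X, U) →+* X.functionField := (X.germToFunctionField U).hom
  -- The ideal of denominators of `h`. It is contained in no prime of `D(s)`, where `h` is regular,
  -- so `s` lies in its radical.
  let I : Ideal Γ(X, U) :=
    { carrier := {d | ∃ a, φ a = φ d * h}
      zero_mem' := ⟨0, by simp⟩
      add_mem' := by
        rintro d d' ⟨a, ha⟩ ⟨a', ha'⟩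
        exact ⟨a + a', by rw [map_add, map_add, ha, ha', add_mul]⟩
      smul_mem' := by
        rintro c d ⟨a, ha⟩
        exact ⟨c * a, by rw [smul_eq_mul, map_mul, map_mul, ha, mul_assoc]⟩ }
  have hs : s ∈ I.radical := by
    rw [Ideal.radical_eq_sInf, Submodule.mem_sInf]
    rintro p ⟨hIp, hp⟩
    by_contra hsp
    have hx : hU.fromSpec ⟨p, hp⟩ ∈ X.basicOpen s := by
      have : (⟨p, hp⟩ : PrimeSpectrum Γ(X, U)) ∈ hU.fromSpec ⁻¹ᵁ X.basicOpen s := by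
        rw [hU.fromSpec_preimage_basicOpen]
        exact hsp
      exact this
    obtain ⟨d, hd, a, ha⟩ := exists_mul_mem_of_mem_regularAt hU ⟨p, hp⟩ (hh _ hx)
    exact hd (hIp ⟨a, ha⟩)
  obtain ⟨N, a, ha⟩ := hs
  exact ⟨N, a, by rw [← map_pow]; exact ha⟩

theorem exists_eq_germToFunctionField {U : X.Opens} [Nonempty U] (hU : IsAffineOpen U)
    (h : X.functionField) (hh : ∀ x ∈ U, h ∈ regularAt X x) :
    ∃ a : Γ(X, U), X.germToFunctionField U a = h := by
  obtain ⟨N, a, ha⟩ := exists_pow_mul_eq_germToFunctionField hU 1 h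
    fun x hx ↦ hh x (X.basicOpen_le _ hx)
  exact ⟨a, by simpa using ha⟩

/-- Two local equations at `x` differ by a unit of the stalk, so any one of them can be used for the
test. -/
theorem isSectionAt_iff {D : CartierDivisor X} {x : X} {e : (X.functionField)ˣ}
    (he : QuotientGroup.mk e = germAt D x) (g : X.functionField) :
    IsSectionAt D g x ↔ e * g ∈ regularAt X x := by
  constructor
  · rintro ⟨e', a, he', hag⟩
    obtain ⟨c, hc⟩ := QuotientGroup.eq.mp (he'.trans he.symm)
    have hc' : algebraMap (X.presheaf.stalk x) X.functionField c =
        (e' : X.functionField)⁻¹ * e := by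
      simpa using congrArg Units.val hc
    refine ⟨c * a, ?_⟩
    rw [map_mul, hc', hag]
    field_simp
  · rintro ⟨a, ha⟩
    exact ⟨e, a, he, ha⟩

theorem exists_mk_eq_germAt (D : CartierDivisor X) (x : X) :
    ∃ e : (X.functionField)ˣ, QuotientGroup.mk e = germAt D x :=
  QuotientGroup.mk_surjective _

theorem mk_mul_eq_germAt_add {D F : CartierDivisor X} {x : X} {e e' : (X.functionField)ˣ}
    (he : QuotientGroup.mk e = germAt D x) (he' : QuotientGroup.mk e' = germAt F x) :
    QuotientGroup.mk (e * e') = germAt (D + F) x := by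
  rw [QuotientGroup.mk_mul, he, he']
  rfl

theorem IsSectionAt.mul {D F : CartierDivisor X} {g h : X.functionField} {x : X}
    (hg : IsSectionAt D g x) (hh : IsSectionAt F h x) : IsSectionAt (D + F) (g * h) x := by
  obtain ⟨e, a, he, ha⟩ := hg
  obtain ⟨e', a', he', ha'⟩ := hh
  refine ⟨e * e', a * a', mk_mul_eq_germAt_add he he', ?_⟩
  rw [map_mul, ha, ha', Units.val_mul]
  ring

theorem IsSectionAt.pow {D : CartierDivisor X} {g : X.functionField} {x : X}
    (hg : IsSectionAt D g x) (n : ℕ) : IsSectionAt (n • D) (g ^ n) x := by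
  obtain ⟨e, a, he, ha⟩ := hg
  refine ⟨e ^ n, a ^ n, mk_eq_germAt_nsmul he n, ?_⟩
  rw [map_pow, ha, mul_pow, Units.val_pow_eq_pow_val]

theorem IsNonvanishingAt.isSectionAt {D : CartierDivisor X} {g : X.functionField} {x : X}
    (hg : IsNonvanishingAt D g x) : IsSectionAt D g x := by
  obtain ⟨e, a, he, -, ha⟩ := hg
  exact ⟨e, a, he, ha⟩

theorem IsNonvanishingAt.mul {D F : CartierDivisor X} {g h : X.functionField} {x : X}
    (hg : IsNonvanishingAt D g x) (hh : IsNonvanishingAt F h x) :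
    IsNonvanishingAt (D + F) (g * h) x := by
  obtain ⟨e, a, he, hu, ha⟩ := hg
  obtain ⟨e', a', he', hu', ha'⟩ := hh
  refine ⟨e * e', a * a', mk_mul_eq_germAt_add he he', hu.mul hu', ?_⟩
  rw [map_mul, ha, ha', Units.val_mul]
  ring

theorem IsNonvanishingAt.pow {D : CartierDivisor X} {g : X.functionField} {x : X}
    (hg : IsNonvanishingAt D g x) (n : ℕ) : IsNonvanishingAt (n • D) (g ^ n) x := by
  obtain ⟨e, a, he, hu, ha⟩ := hg
  refine ⟨e ^ n, a ^ n, mk_eq_germAt_nsmul he n, hu.pow n, ?_⟩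
  rw [map_pow, ha, mul_pow, Units.val_pow_eq_pow_val]

/-- A product of sections is nonvanishing only where both factors are. -/
theorem IsNonvanishingAt.left_of_mul {D F : CartierDivisor X} {g h : X.functionField} {x : X}
    (hgh : IsNonvanishingAt (D + F) (g * h) x) (hg : IsSectionAt D g x)
    (hh : IsSectionAt F h x) : IsNonvanishingAt D g x := by
  obtain ⟨e, a, he, ha⟩ := hg
  obtain ⟨e', a', he', ha'⟩ := hh
  obtain ⟨c, hc, hce⟩ := (isNonvanishingAt_iff _ _ _ _ (mk_mul_eq_germAt_add he he')).mp hgh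
  refine ⟨e, a, he, isUnit_of_mul_isUnit_left (y := a') ?_, ha⟩
  convert hc
  apply IsFractionRing.injective (X.presheaf.stalk x) X.functionField
  rw [map_mul, ha, ha', hce, Units.val_mul]
  ring

/-- Near every point there is an affine open set on which `D` has one equation. -/
theorem exists_isAffineOpen_forall_mk_eq_germAt (D : CartierDivisor X) (x : X) (W : X.Opens)
    (hW : x ∈ W) : ∃ U : X.Opens, IsAffineOpen U ∧ x ∈ U ∧ U ≤ W ∧
      ∃ e : (X.functionField)ˣ, ∀ y ∈ U, QuotientGroup.mk e = germAt D y := by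
  obtain ⟨V, hxV, e, he⟩ := D.toMul.2 x
  obtain ⟨_, ⟨U, hU, rfl⟩, hxU, hUV⟩ :=
    X.isBasis_affineOpens.exists_subset_of_mem_open (show x ∈ V ⊓ W from ⟨hxV, hW⟩) (V ⊓ W).isOpen
  exact ⟨U, hU, hxU, fun y hy ↦ (hUV hy).2, e, fun y hy ↦ (he y (hUV hy).1).symm⟩

/-- A section of `𝒪(F)` over `X_g` extends to `X` after multiplication with a power of `g`. -/
theorem exists_pow_mul_mem_globalSections [CompactSpace X] {D : CartierDivisor X}
    {g : X.functionField} (hg : g ∈ globalSections D) (F : CartierDivisor X)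
    (h : X.functionField) (hh : ∀ x ∈ nonvanishingLocus D g, IsSectionAt F h x) :
    ∃ N : ℕ, g ^ N * h ∈ globalSections (N • D + F) := by
  have hloc (x : X) : ∃ U : X.Opens, x ∈ U ∧ ∃ N : ℕ, ∀ y ∈ U,
      IsSectionAt (N • D + F) (g ^ N * h) y := by
    obtain ⟨V, -, hxV, -, e, he⟩ := exists_isAffineOpen_forall_mk_eq_germAt D x ⊤ trivial
    obtain ⟨U, hU, hxU, hUV, e', he'⟩ := exists_isAffineOpen_forall_mk_eq_germAt F x V hxV
    have : Nonempty U := ⟨⟨x, hxU⟩⟩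
    obtain ⟨s, hs⟩ := exists_eq_germToFunctionField hU (e * g) fun y hy ↦
      (isSectionAt_iff (he y (hUV hy)) g).mp (hg y)
    -- The basic open set of `s = e * g` lies in `X_g`, where `h` is a section; hence `e' * h` is
    -- regular on it.
    obtain ⟨N, a, ha⟩ := exists_pow_mul_eq_germToFunctionField hU s (e' * h) fun y hy ↦ by
      have hyU := X.basicOpen_le s hy
      refine (isSectionAt_iff (he' y hyU) h).mp (hh y ?_)
      refine (isNonvanishingAt_iff D g y e (he y (hUV hyU))).mpr
        ⟨X.presheaf.germ U y hyU s, (X.mem_basicOpen s y hyU).mp hy, ?_⟩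
      rw [Scheme.algebraMap_germ_eq_germToFunctionField, hs]
    refine ⟨U, hxU, N, fun y hy ↦ ?_⟩
    rw [isSectionAt_iff (mk_mul_eq_germAt_add (mk_eq_germAt_nsmul (he y (hUV hy)) N) (he' y hy))]
    convert germToFunctionField_mem_regularAt hy a using 1
    rw [ha, hs, Units.val_mul, Units.val_pow_eq_pow_val]
    ring
  choose U hxU N hN using hloc
  obtain ⟨t, ht⟩ := isCompact_univ.elim_finite_subcover (fun x ↦ (U x : Set X))
    (fun x ↦ (U x).isOpen) fun x _ ↦ Set.mem_iUnion.mpr ⟨x, hxU x⟩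
  -- Raising a local exponent to the maximum multiplies by a further power of the section `g`, which
  -- creates no poles.
  refine ⟨t.sup N, fun y ↦ ?_⟩
  obtain ⟨x, hxt, hy⟩ := Set.mem_iUnion₂.mp (ht (Set.mem_univ y))
  obtain ⟨d, hd⟩ := Nat.exists_eq_add_of_le (Finset.le_sup (f := N) hxt)
  have h3 := ((hg y).pow d).mul (hN x y hy)
  rw [← add_assoc, ← add_smul, ← mul_assoc, ← pow_add, add_comm d, ← hd] at h3
  exact h3

/-- For an ample divisor `A`, the sets `X_g` form a basis of the topology. -/
theorem IsAmple.exists_nonvanishingLocus_le {A : CartierDivisor X} (hA : IsAmple A) (x : X)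
    (W : X.Opens) (hW : x ∈ W) : ∃ n : ℕ, 0 < n ∧ ∃ g ∈ globalSections (n • A),
      x ∈ nonvanishingLocus (n • A) g ∧ nonvanishingLocus (n • A) g ≤ W := by
  have := hA.1
  obtain ⟨n, hn, g, hg, hxg, haff⟩ := hA.2 x
  generalize hD : n • A = D at hg hxg haff
  generalize hV : nonvanishingLocus D g = V at hxg haff
  obtain ⟨b, hbW, hxb⟩ := haff.exists_basicOpen_le (V := W) ⟨x, hW⟩ hxg
  have : Nonempty V := ⟨⟨x, hxg⟩⟩
  have h0 (y : X) : QuotientGroup.mk (1 : (X.functionField)ˣ) =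
    germAt (0 : CartierDivisor X) y := rfl
  obtain ⟨M, hM⟩ := exists_pow_mul_mem_globalSections hg 0 (X.germToFunctionField V b)
    fun y hy ↦ by
      rw [isSectionAt_iff (h0 y), Units.val_one, one_mul]
      exact germToFunctionField_mem_regularAt (hV ▸ hy) b
  -- The factor `g` beyond `g ^ M` forces the nonvanishing locus into `X_g = V` even when `M = 0`;
  -- inside `V` the factor `b` cuts it down to `D(b)`.
  have key : (1 + M) • D + 0 = D + (M • D + 0) := by rw [add_smul, one_smul, add_assoc]
  have key' : ((1 + M) * n) • A = (1 + M) • D + 0 := by rw [add_zero, ← hD, smul_smul]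
  have keyg : g ^ (1 + M) * X.germToFunctionField V b =
    g * (g ^ M * X.germToFunctionField V b) := by ring
  have hsec : g ^ (1 + M) * X.germToFunctionField V b ∈ globalSections ((1 + M) • D + 0) :=
    fun y ↦ by
      rw [key, keyg]
      exact (hg y).mul (hM y)
  refine ⟨(1 + M) * n, by positivity, g ^ (1 + M) * X.germToFunctionField V b, ?_⟩
  rw [key']
  refine ⟨hsec, ?_, fun y hy ↦ hbW ?_⟩
  · have hxg' : IsNonvanishingAt D g x := hV.ge hxg
    refine (hxg'.pow _).mul ⟨1, X.presheaf.germ V x hxg b, h0 x, (X.mem_basicOpen b x hxg).mp hxb, ?_⟩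
    rw [Scheme.algebraMap_germ_eq_germToFunctionField, Units.val_one, one_mul]
  · have hy' : IsNonvanishingAt ((1 + M) • D + 0) (g ^ (1 + M) * X.germToFunctionField V b) y := hy
    have hyV : y ∈ V := by
      rw [key, keyg] at hy'
      exact hV.le <| hy'.left_of_mul (hg y) (hM y)
    have hb : IsSectionAt 0 (X.germToFunctionField V b) y := by
      rw [isSectionAt_iff (h0 y), Units.val_one, one_mul]
      exact germToFunctionField_mem_regularAt hyV b
    rw [add_comm, mul_comm] at hy'
    obtain ⟨a, ha, hab⟩ := (isNonvanishingAt_iff _ _ _ _ (h0 y)).mp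
      (hy'.left_of_mul hb ((hg y).pow _))
    rw [X.mem_basicOpen b y hyV]
    convert ha
    apply IsFractionRing.injective (X.presheaf.stalk y) X.functionField
    rw [hab, Units.val_one, one_mul]
    exact Scheme.algebraMap_germ_eq_germToFunctionField X hyV b

/-- Large multiples of an ample divisor absorb every divisor. -/
theorem IsAmple.exists_notMem_baseLocus {A : CartierDivisor X} (hA : IsAmple A)
    (F : CartierDivisor X) (x : X) : ∃ q : ℕ, 0 < q ∧ x ∉ baseLocus (q • A + F) := by
  have := hA.1
  obtain ⟨W, -, hxW, -, e, he⟩ := exists_isAffineOpen_forall_mk_eq_germAt F x ⊤ trivial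
  obtain ⟨n, hn, g, hg, hxg, hgW⟩ := hA.exists_nonvanishingLocus_le x W hxW
  -- `e⁻¹` generates `𝒪(F)` over `W`, hence over `X_g`, and a power of `g` clears its poles
  -- elsewhere. One more factor `g` keeps the multiple of `A` positive.
  have hnv : ∀ y ∈ W, IsNonvanishingAt F (e⁻¹ : (X.functionField)ˣ) y := fun y hy ↦
    ⟨e, 1, he y hy, isUnit_one, by rw [map_one, Units.mul_inv]⟩
  obtain ⟨N, hN⟩ := exists_pow_mul_mem_globalSections hg F (e⁻¹ : (X.functionField)ˣ)
    fun y hy ↦ (hnv y (hgW hy)).isSectionAt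
  refine ⟨(1 + N) * n, by positivity, fun hx ↦ ?_⟩
  have key : ((1 + N) * n) • A + F = n • A + (N • n • A + F) := by
    rw [add_mul, one_mul, add_smul, mul_smul, add_assoc]
  rw [key] at hx
  exact hx (g * (g ^ N * (e⁻¹ : (X.functionField)ˣ))) (fun y ↦ (hg y).mul (hN y))
    (IsNonvanishingAt.mul hxg ((IsNonvanishingAt.pow hxg N).mul (hnv x hxW)))

end Sections

/-! ### Stable base loci and real linear equivalence -/

section StableBaseLocus

variable {X : Scheme.{u}} [IsIntegral X]

theorem notMem_baseLocus_iff {L : CartierDivisor X} {x : X} :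
    x ∉ baseLocus L ↔ ∃ g ∈ globalSections L, IsNonvanishingAt L g x := by
  change (¬ ∀ g ∈ globalSections L, ¬ IsNonvanishingAt L g x) ↔ _
  push Not
  rfl

theorem mem_iInf_pos_closeds {α : Type*} [TopologicalSpace α] {Z : ℕ → Closeds α} {x : α} :
    x ∈ ⨅ (m : ℕ) (_ : 0 < m), Z m ↔ ∀ m : ℕ, 0 < m → x ∈ Z m := by
  simp only [← SetLike.mem_coe, Closeds.coe_iInf, Set.mem_iInter]

theorem notMem_stableBaseSet_iff {L : CartierDivisor X} {x : X} :
    x ∉ stableBaseSet L ↔ ∃ m : ℕ, 0 < m ∧ x ∉ baseLocus (m • L) := by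
  rw [stableBaseSet, mem_iInf_pos_closeds]
  push Not
  rfl

theorem notMem_stableBaseSet_of_notMem_baseLocus {L : CartierDivisor X} {x : X}
    (h : x ∉ baseLocus L) : x ∉ stableBaseSet L :=
  notMem_stableBaseSet_iff.mpr ⟨1, one_pos, by rwa [one_smul]⟩

theorem notMem_baseLocus_add {L F : CartierDivisor X} {x : X} (hL : x ∉ baseLocus L)
    (hF : x ∉ baseLocus F) : x ∉ baseLocus (L + F) := by
  rw [notMem_baseLocus_iff] at *
  obtain ⟨g, hg, hgx⟩ := hL
  obtain ⟨h, hh, hhx⟩ := hF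
  exact ⟨g * h, fun y ↦ (hg y).mul (hh y), hgx.mul hhx⟩

theorem notMem_stableBaseSet_add {L F : CartierDivisor X} {x : X} (hL : x ∉ stableBaseSet L)
    (hF : x ∉ stableBaseSet F) : x ∉ stableBaseSet (L + F) := by
  obtain ⟨m, hm, hmx⟩ := notMem_stableBaseSet_iff.mp hL
  obtain ⟨n, hn, hnx⟩ := notMem_stableBaseSet_iff.mp hF
  refine notMem_stableBaseSet_iff.mpr ⟨n * m, Nat.mul_pos hn hm, ?_⟩
  rw [smul_add]
  refine notMem_baseLocus_add (fun h ↦ hmx ?_) fun h ↦ hnx ?_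
  · rw [mul_smul] at h
    exact baseLocus_nsmul_le _ n h
  · rw [mul_comm, mul_smul] at h
    exact baseLocus_nsmul_le _ m h

theorem notMem_stableBaseSet_principal (g : (X.functionField)ˣ) (x : X) :
    x ∉ stableBaseSet (principal g) := by
  have h (y : X) : IsNonvanishingAt (principal g) (g⁻¹ : (X.functionField)ˣ) y :=
    ⟨g, 1, rfl, isUnit_one, by rw [map_one, Units.mul_inv]⟩
  exact notMem_stableBaseSet_of_notMem_baseLocus <|
    notMem_baseLocus_iff.mpr ⟨_, fun y ↦ (h y).isSectionAt, h x⟩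

theorem notMem_stableBaseSet_nsmul {L : CartierDivisor X} {x : X} (hL : x ∉ stableBaseSet L)
    (n : ℕ) : x ∉ stableBaseSet (n • L) := by
  rcases n.eq_zero_or_pos with rfl | hn
  · rw [zero_smul]
    exact notMem_stableBaseSet_principal 1 x
  · rwa [stableBaseSet_nsmul L hn]

theorem zsmul_principal (n : ℤ) (g : (X.functionField)ˣ) :
    n • principal g = principal (g ^ n) := rfl

/-- A `ℚ`-divisor has a positive multiple that is a Cartier divisor. -/
theorem exists_nsmul_eq_one_tmul (D : QDivisor X) :
    ∃ b : ℕ, 0 < b ∧ ∃ L : CartierDivisor X, b • D = 1 ⊗ₜ[ℤ] L := by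
  obtain ⟨⟨L, c⟩, hc⟩ := IsLocalizedModule.surj (nonZeroDivisors ℤ)
    (TensorProduct.mk ℤ ℚ (CartierDivisor X) 1) D
  have hc1 : (c : ℤ) • D = (1 : ℚ) ⊗ₜ[ℤ] L := hc
  refine ⟨(c : ℤ).natAbs, Int.natAbs_pos.mpr (nonZeroDivisors.ne_zero c.2), ?_⟩
  rcases Int.natAbs_eq (c : ℤ) with h1 | h1 <;> rw [h1] at hc1
  · exact ⟨L, by simpa only [natCast_zsmul] using hc1⟩
  · refine ⟨-L, ?_⟩
    rw [TensorProduct.tmul_neg, ← hc1, neg_smul, natCast_zsmul, neg_neg]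

theorem stableBaseSetQ_one_tmul (L : CartierDivisor X) :
    stableBaseSetQ (1 ⊗ₜ[ℤ] L : QDivisor X) = stableBaseSet L :=
  stableBaseSetQ_eq one_pos (one_smul _ _)

theorem notMem_stableBaseSetQ_add {D D' : QDivisor X} {x : X} (hD : x ∉ stableBaseSetQ D)
    (hD' : x ∉ stableBaseSetQ D') : x ∉ stableBaseSetQ (D + D') := by
  obtain ⟨b, hb, L, hL⟩ := exists_nsmul_eq_one_tmul D
  obtain ⟨b', hb', L', hL'⟩ := exists_nsmul_eq_one_tmul D'
  rw [stableBaseSetQ_eq hb hL] at hD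
  rw [stableBaseSetQ_eq hb' hL'] at hD'
  have key : (b * b') • (D + D') = 1 ⊗ₜ[ℤ] (b' • L + b • L') := by
    rw [TensorProduct.tmul_add, TensorProduct.tmul_smul, TensorProduct.tmul_smul, ← hL, ← hL',
      smul_add, smul_smul, smul_smul, mul_comm b]
  rw [stableBaseSetQ_eq (Nat.mul_pos hb hb') key]
  exact notMem_stableBaseSet_add (notMem_stableBaseSet_nsmul hD _)
    (notMem_stableBaseSet_nsmul hD' _)

theorem notMem_stableBaseSetQ_sum {ι : Type*} (s : Finset ι) {D : ι → QDivisor X} {x : X}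
    (h : ∀ i ∈ s, x ∉ stableBaseSetQ (D i)) : x ∉ stableBaseSetQ (∑ i ∈ s, D i) := by
  refine Finset.sum_induction D (x ∉ stableBaseSetQ ·) (fun _ _ ↦ notMem_stableBaseSetQ_add) ?_ h
  rw [← TensorProduct.tmul_zero (R := ℤ) (CartierDivisor X) (1 : ℚ), stableBaseSetQ_one_tmul]
  exact notMem_stableBaseSet_principal 1 x

theorem den_nsmul_tmul (r : ℚ) (P : CartierDivisor X) :
    r.den • (r ⊗ₜ[ℤ] P : QDivisor X) = 1 ⊗ₜ[ℤ] (r.num • P) := by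
  rw [← TensorProduct.smul_tmul, TensorProduct.smul_tmul', nsmul_eq_mul, zsmul_one,
    Rat.den_mul_eq_num]

theorem notMem_stableBaseSetQ_tmul {r : ℚ} (hr : 0 ≤ r) {P : CartierDivisor X} {x : X}
    (hP : x ∉ stableBaseSet P) : x ∉ stableBaseSetQ (r ⊗ₜ[ℤ] P) := by
  rw [stableBaseSetQ_eq r.den_pos (den_nsmul_tmul r P)]
  obtain ⟨n, hn⟩ := Int.eq_ofNat_of_zero_le (Rat.num_nonneg.mpr hr)
  rw [hn, natCast_zsmul]
  exact notMem_stableBaseSet_nsmul hP n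

/-- No sign condition on `r` is needed: negative multiples of a principal divisor are principal too.
-/
theorem notMem_stableBaseSetQ_tmul_principal (r : ℚ) (g : (X.functionField)ˣ) (x : X) :
    x ∉ stableBaseSetQ (r ⊗ₜ[ℤ] principal g) := by
  rw [stableBaseSetQ_eq r.den_pos (den_nsmul_tmul r _), zsmul_principal]
  exact notMem_stableBaseSet_principal _ x

/-- If a Cartier divisor is `ℝ`-linearly equivalent to a combination with nonnegative real
coefficients of divisors that are semiample at `x`, then it is semiample at `x`. -/
theorem notMem_stableBaseSet_of_rLinearEquiv {ι : Type*} [Fintype ι] {E : CartierDivisor X}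
    {r : ι → ℝ} {P : ι → CartierDivisor X} {x : X} (hr : ∀ i, 0 ≤ r i)
    (hP : ∀ i, x ∉ stableBaseSet (P i))
    (hE : RLinearEquiv (1 ⊗ₜ[ℤ] E) (∑ i, r i ⊗ₜ[ℤ] P i)) : x ∉ stableBaseSet E := by
  obtain ⟨c, hc⟩ := Finsupp.mem_span_range_iff_exists_finsupp.mp hE
  obtain ⟨φ, hφ1, hφ⟩ := exists_linearMap_rat_pos (Finset.univ.image r)
  -- `φ ⊗ id` fixes `1 ⊗ E`, keeps the coefficients of the `P i` nonnegative, and sends the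
  -- principal terms to rational multiples of principal divisors, whose signs do not matter.
  let Φ : RDivisor X →ₗ[ℤ] QDivisor X :=
    TensorProduct.map φ.toAddMonoidHom.toIntLinearMap LinearMap.id
  have hΦ (a : ℝ) (D : CartierDivisor X) : Φ (a ⊗ₜ[ℤ] D) = φ a ⊗ₜ[ℤ] D := rfl
  have h := congrArg Φ (eq_sub_iff_add_eq.mp hc)
  rw [map_add, hΦ, hφ1, map_sum, Finsupp.sum, map_sum] at h
  rw [← stableBaseSetQ_one_tmul, ← h]
  refine notMem_stableBaseSetQ_add (notMem_stableBaseSetQ_sum _ fun g _ ↦ ?_)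
    (notMem_stableBaseSetQ_sum _ fun i _ ↦ ?_)
  · rw [TensorProduct.smul_tmul', hΦ]
    exact notMem_stableBaseSetQ_tmul_principal _ _ _
  · rw [hΦ]
    refine notMem_stableBaseSetQ_tmul ?_ (hP i)
    rcases (hr i).eq_or_lt with h0 | h0
    · rw [← h0, map_zero]
    · exact (hφ _ (Finset.mem_image_of_mem r (Finset.mem_univ i)) h0).le

/-- The augmented base locus at `x` does not depend on the choices, provided that the divisors in
the representations are semiample at `x`. -/
theorem exists_notMem_stableBaseSet_floor {ι ι' : Type*} [Fintype ι] [Fintype ι']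
    {t : ι → ℝ} {t' : ι' → ℝ} {B : ι → CartierDivisor X} {B' : ι' → CartierDivisor X}
    (A : CartierDivisor X) {A' : CartierDivisor X} {x : X} (hA' : IsAmple A')
    (hB : ∀ i, x ∉ stableBaseSet (B i)) (hB' : ∀ j, x ∉ stableBaseSet (B' j))
    (hBB' : RLinearEquiv (∑ i, t i ⊗ₜ[ℤ] B i) (∑ j, t' j ⊗ₜ[ℤ] B' j)) {m : ℕ} (hm : 0 < m)
    (hx : x ∉ stableBaseSet (∑ j, ⌊(m : ℝ) * t' j⌋ • B' j - A')) :
    ∃ M : ℕ, 0 < M ∧ x ∉ stableBaseSet (∑ i, ⌊(M : ℝ) * t i⌋ • B i - A) := by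
  -- `q • A'` has to absorb `-A` and also `-∑ B i`. The latter compensates the rounding: it turns
  -- the coefficients `-fract` of the `B i` into `1 - fract ≥ 0`.
  obtain ⟨q, hq, hqx⟩ := hA'.exists_notMem_baseLocus (-A - ∑ i, B i) x
  refine ⟨m * q, Nat.mul_pos hm hq, ?_⟩
  set L' := ∑ j, ⌊(m : ℝ) * t' j⌋ • B' j - A' with hL'
  set L := ∑ i, ⌊((m * q : ℕ) : ℝ) * t i⌋ • B i - A with hL
  rw [← sub_add_cancel L (q • L')]
  refine notMem_stableBaseSet_add ?_ (notMem_stableBaseSet_nsmul hx q)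
  refine notMem_stableBaseSet_of_rLinearEquiv (ι := Unit ⊕ (ι ⊕ ι'))
    (r := Sum.elim (fun _ ↦ 1) (Sum.elim (fun i ↦ 1 - Int.fract (((m * q : ℕ) : ℝ) * t i))
      (fun j ↦ q * Int.fract ((m : ℝ) * t' j))))
    (P := Sum.elim (fun _ ↦ q • A' + (-A - ∑ i, B i)) (Sum.elim B B')) ?_ ?_ ?_
  · rintro (_ | i | j)
    · exact zero_le_one
    · exact sub_nonneg.mpr (Int.fract_lt_one _).le
    · exact mul_nonneg q.cast_nonneg (Int.fract_nonneg _)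
  · rintro (_ | i | j)
    · exact notMem_stableBaseSet_of_notMem_baseLocus hqx
    · exact hB i
    · exact hB' j
  · have hfloor (a : ℝ) (D : CartierDivisor X) :
        (1 : ℝ) ⊗ₜ[ℤ] (⌊a⌋ • D) = a ⊗ₜ[ℤ] D - Int.fract a ⊗ₜ[ℤ] D := by
      rw [← TensorProduct.smul_tmul, zsmul_one, ← TensorProduct.sub_tmul, Int.self_sub_fract]
    have hmul (a b : ℝ) (D : CartierDivisor X) :
        (a * b) ⊗ₜ[ℤ] D = a • (b ⊗ₜ[ℤ] D : RDivisor X) := rfl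
    -- Multiplied by `m * q`, the given equivalence cancels the unrounded parts of `L` and `q • L'`;
    -- only fractional parts and the ample terms remain.
    have key := Submodule.smul_mem _ ((m * q : ℕ) : ℝ) hBB'
    unfold RLinearEquiv
    convert key using 1
    simp only [Fintype.sum_sum_type, Sum.elim_inl, Sum.elim_inr, Finset.univ_unique,
      Finset.sum_singleton, hL, hL', TensorProduct.tmul_sub, TensorProduct.tmul_add,
      TensorProduct.tmul_neg, TensorProduct.tmul_sum, TensorProduct.tmul_smul, hfloor,
      TensorProduct.sub_tmul, Finset.sum_sub_distrib, hmul, ← Finset.smul_sum, smul_sub]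
    push_cast
    simp only [mul_smul, ← Nat.cast_smul_eq_nsmul ℝ, smul_comm (m : ℝ) (q : ℝ)]
    abel

end StableBaseLocus

/-! ### Pullback of divisors along a dominant morphism -/

section PullbackSections

variable {X Y : Scheme.{u}} [IsIntegral X] [IsIntegral Y] (f : X ⟶ Y) [IsDominant f]

theorem mk_map_eq_germAt_pullbackCartier {D : CartierDivisor Y} {x : X}
    {e : (Y.functionField)ˣ} (he : QuotientGroup.mk e = germAt D (f x)) :
    QuotientGroup.mk (Units.map (functionFieldMap f : Y.functionField →* X.functionField) e) =
      germAt (pullbackCartier f D) x :=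
  congrArg (pullbackGerm f x) he

theorem IsSectionAt.pullback {D : CartierDivisor Y} {g : Y.functionField} {x : X}
    (hg : IsSectionAt D g (f x)) :
    IsSectionAt (pullbackCartier f D) (functionFieldMap f g) x := by
  obtain ⟨e, a, he, ha⟩ := hg
  refine ⟨_, (f.stalkMap x).hom a, mk_map_eq_germAt_pullbackCartier f he, ?_⟩
  rw [← functionFieldMap_algebraMap, ha, map_mul]
  rfl

theorem functionFieldMap_mem_globalSections {D : CartierDivisor Y} {g : Y.functionField}
    (hg : g ∈ globalSections D) :
    functionFieldMap f g ∈ globalSections (pullbackCartier f D) :=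
  fun x ↦ (hg (f x)).pullback f

/-- The stalk map is local, so it both preserves and reflects units. -/
theorem isNonvanishingAt_pullback_iff {D : CartierDivisor Y} {g : Y.functionField} {x : X}
    (hg : IsSectionAt D g (f x)) :
    IsNonvanishingAt (pullbackCartier f D) (functionFieldMap f g) x ↔
      IsNonvanishingAt D g (f x) := by
  obtain ⟨e, a, he, ha⟩ := hg
  have key : algebraMap (X.presheaf.stalk x) X.functionField ((f.stalkMap x).hom a) =
      (Units.map (functionFieldMap f : Y.functionField →* X.functionField) e :) *
        functionFieldMap f g := by
    rw [← functionFieldMap_algebraMap, ha, map_mul]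
    rfl
  constructor
  · intro h
    obtain ⟨b, hb, hbg⟩ := (isNonvanishingAt_iff _ _ _ _
      (mk_map_eq_germAt_pullbackCartier f he)).mp h
    refine ⟨e, a, he, isUnit_of_map_unit (f.stalkMap x).hom a ?_, ha⟩
    convert hb
    exact IsFractionRing.injective (X.presheaf.stalk x) X.functionField (key.trans hbg.symm)
  · intro h
    obtain ⟨b, hb, hbg⟩ := (isNonvanishingAt_iff _ _ _ _ he).mp h
    have : a = b :=
      IsFractionRing.injective (Y.presheaf.stalk (f x)) Y.functionField (ha.trans hbg.symm)
    exact ⟨_, _, mk_map_eq_germAt_pullbackCartier f he, (this ▸ hb).map (f.stalkMap x).hom, key⟩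

theorem nonvanishingLocus_pullback {D : CartierDivisor Y} {g : Y.functionField}
    (hg : g ∈ globalSections D) :
    nonvanishingLocus (pullbackCartier f D) (functionFieldMap f g) =
      f ⁻¹ᵁ nonvanishingLocus D g :=
  Opens.ext <| Set.ext fun x ↦ isNonvanishingAt_pullback_iff f (hg (f x))

theorem notMem_baseLocus_pullback {L : CartierDivisor Y} {x : X} (h : f x ∉ baseLocus L) :
    x ∉ baseLocus (pullbackCartier f L) := by
  obtain ⟨g, hg, hgx⟩ := notMem_baseLocus_iff.mp h
  exact notMem_baseLocus_iff.mpr ⟨_, functionFieldMap_mem_globalSections f hg,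
    (isNonvanishingAt_pullback_iff f (hg _)).mpr hgx⟩

theorem notMem_stableBaseSet_pullback {L : CartierDivisor Y} {x : X}
    (h : f x ∉ stableBaseSet L) : x ∉ stableBaseSet (pullbackCartier f L) := by
  obtain ⟨m, hm, hmx⟩ := notMem_stableBaseSet_iff.mp h
  refine notMem_stableBaseSet_iff.mpr ⟨m, hm, ?_⟩
  rw [← map_nsmul]
  exact notMem_baseLocus_pullback f hmx

/-- The pullback of an ample divisor along an affine morphism is ample. -/
theorem IsAmple.pullback [IsAffineHom f] {A : CartierDivisor Y} (hA : IsAmple A) :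
    IsAmple (pullbackCartier f A) := by
  have := hA.1
  refine ⟨QuasiCompact.compactSpace_of_compactSpace f, fun x ↦ ?_⟩
  obtain ⟨n, hn, g, hg, hx, haff⟩ := hA.2 (f x)
  refine ⟨n, hn, functionFieldMap f g, ?_⟩
  rw [← map_nsmul, nonvanishingLocus_pullback f hg]
  exact ⟨functionFieldMap_mem_globalSections f hg, hx, haff.preimage f⟩

theorem functionFieldMap_germToFunctionField (V : Y.Opens) [Nonempty V] [Nonempty (f ⁻¹ᵁ V)]
    (a : Γ(Y, V)) : functionFieldMap f (Y.germToFunctionField V a) =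
      X.germToFunctionField (f ⁻¹ᵁ V) ((f.app V).hom a) := by
  obtain ⟨x, hx⟩ := ‹Nonempty (f ⁻¹ᵁ V)›
  rw [← Scheme.algebraMap_germ_eq_germToFunctionField Y (x := f x) hx,
    functionFieldMap_algebraMap]
  erw [Scheme.Hom.germ_stalkMap_apply f V x hx a]
  exact Scheme.algebraMap_germ_eq_germToFunctionField X hx _

end PullbackSections

/-! ### Descent of sections along a finite morphism to a normal scheme -/

/-- Over an integrally closed domain, if `e • θ` is integral then its minimal polynomial arises
from that of `θ` over the fraction field by scaling the roots. -/
theorem exists_monic_coeff_eq_scaleRoots {A K L : Type*} [CommRing A] [IsDomain A]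
    [IsIntegrallyClosed A] [Field K] [Algebra A K] [IsFractionRing A K] [Field L] [Algebra K L]
    [Algebra A L] [IsScalarTower A K L] {e : K} (he : e ≠ 0) {θ : L}
    (h : _root_.IsIntegral A (e • θ)) :
    ∃ p : Polynomial A, p.Monic ∧ p.natDegree = (minpoly K θ).natDegree ∧
      Polynomial.aeval (e • θ) p = 0 ∧ ∀ i, algebraMap A K (p.coeff i) =
        (minpoly K θ).coeff i * e ^ ((minpoly K θ).natDegree - i) := by
  have hθ : _root_.IsIntegral K θ := by
    have h1 := (h.tower_top (A := K)).smul e⁻¹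
    rwa [smul_smul, inv_mul_cancel₀ he, one_smul] at h1
  have hmap : (minpoly A (e • θ)).map (algebraMap A K) = (minpoly K θ).scaleRoots e := by
    rw [← minpoly.isIntegrallyClosed_eq_field_fractions' K h, IsIntegrallyClosed.minpoly_smul he hθ]
  refine ⟨minpoly A (e • θ), minpoly.monic h, ?_, minpoly.aeval _ _, fun i ↦ ?_⟩
  · rw [← (minpoly.monic h).natDegree_map (algebraMap A K), hmap, Polynomial.natDegree_scaleRoots]
  · rw [← Polynomial.coeff_map, hmap, Polynomial.coeff_scaleRoots]

/-- A monic polynomial over a local ring with a root that is a unit in a local extension has a unit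
among its lower coefficients. -/
theorem exists_isUnit_coeff_of_isUnit_root {A B : Type*} [CommRing A] [IsLocalRing A]
    [CommRing B] [IsLocalRing B] (φ : A →+* B) [IsLocalHom φ] {p : Polynomial A} (hp : p.Monic)
    {u : B} (hu : IsUnit u) (h : p.eval₂ φ u = 0) :
    ∃ i < p.natDegree, IsUnit (p.coeff i) := by
  by_contra! hc
  rw [Polynomial.eval₂_eq_sum_range, Finset.sum_range_succ, hp.coeff_natDegree, map_one,
    one_mul] at h
  -- As `φ` is local, non-unit coefficients map into the maximal ideal, which then contains the
  -- power of `u` given by the leading term.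
  have hm : ∑ i ∈ Finset.range p.natDegree, φ (p.coeff i) * u ^ i ∈ IsLocalRing.maximalIdeal B :=
    Ideal.sum_mem _ fun i hi ↦ Ideal.mul_mem_right _ _ <|
      (IsLocalRing.mem_maximalIdeal _).mpr fun hu' ↦
        hc i (Finset.mem_range.mp hi) (isUnit_of_map_unit φ _ hu')
  have h2 : u ^ p.natDegree ∈ IsLocalRing.maximalIdeal B := by
    rw [eq_neg_of_add_eq_zero_right h]
    exact neg_mem hm
  exact (IsLocalRing.mem_maximalIdeal _).mp h2 (hu.pow _)

section Finite

variable {X Y : Scheme.{u}} [IsIntegral X] [IsIntegral Y] (f : X ⟶ Y) [IsDominant f]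

/-- For an integral morphism, a local equation of `D` times a section of `𝒪(f^* D)` is integral
over the local ring of the target. -/
theorem isIntegralElem_of_mem_globalSections [IsIntegralHom f] {D : CartierDivisor Y}
    {g : X.functionField} (hg : g ∈ globalSections (pullbackCartier f D)) {y : Y}
    {e : (Y.functionField)ˣ} (he : QuotientGroup.mk e = germAt D y) :
    ((functionFieldMap f).comp (algebraMap (Y.presheaf.stalk y) Y.functionField)).IsIntegralElem
      (functionFieldMap f e * g) := by
  -- An equation `e'` valid on a whole affine `V` makes `e' * g` a regular function on the affine
  -- set `f⁻¹ V`, hence integral over `Γ(Y, V)`. The given `e` differs from `e'` by a unit at `y`.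
  obtain ⟨V, hV, hyV, -, e', he'⟩ := exists_isAffineOpen_forall_mk_eq_germAt D y ⊤ trivial
  have hne : Nonempty V := ⟨⟨y, hyV⟩⟩
  have hne' : Nonempty (f ⁻¹ᵁ V) := by
    obtain ⟨x, hx⟩ := f.denseRange.exists_mem_open V.isOpen ⟨y, hyV⟩
    exact ⟨⟨x, hx⟩⟩
  obtain ⟨b, hb⟩ := exists_eq_germToFunctionField (hV.preimage f) (functionFieldMap f e' * g)
    fun x hx ↦ (isSectionAt_iff (mk_map_eq_germAt_pullbackCartier f (he' (f x) hx)) g).mp (hg x)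
  have hint : ((functionFieldMap f).comp
      (algebraMap (Y.presheaf.stalk y) Y.functionField)).IsIntegralElem
        (functionFieldMap f e' * g) := by
    obtain ⟨p, hp, hpb⟩ := f.isIntegral_app V hV b
    refine ⟨p.map (Y.presheaf.germ V y hyV).hom, hp.map _, ?_⟩
    have h := congrArg (X.germToFunctionField (f ⁻¹ᵁ V)).hom hpb
    rw [Polynomial.hom_eval₂, map_zero] at h
    rw [Polynomial.eval₂_map, ← hb, ← h]
    congr 1
    ext a
    simp only [RingHom.comp_apply]
    rw [← functionFieldMap_germToFunctionField]
    exact congrArg _ (Scheme.algebraMap_germ_eq_germToFunctionField Y hyV a)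
  obtain ⟨c, hc⟩ := QuotientGroup.eq.mp ((he' y hyV).trans he.symm)
  have hc' : algebraMap (Y.presheaf.stalk y) Y.functionField c =
      (e' : Y.functionField)⁻¹ * e := by
    simpa using congrArg Units.val hc
  have hce : functionFieldMap f e * g =
      ((functionFieldMap f).comp (algebraMap (Y.presheaf.stalk y) Y.functionField)) c *
        (functionFieldMap f e' * g) := by
    rw [RingHom.comp_apply, hc', ← mul_assoc, ← map_mul]
    congr 2
    field_simp
  rw [hce]
  exact (RingHom.isIntegralElem_map _).mul _ hint

/-- If a section of `𝒪(f^* D)` does not vanish at `x`, then some coefficient of its minimal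
polynomial is a section of a multiple of `D` that does not vanish at `f x`. -/
theorem notMem_stableBaseSet_of_notMem_baseLocus_pullback [IsIntegralHom f] [IsNormalScheme Y]
    {D : CartierDivisor Y} {x : X} (hx : x ∉ baseLocus (pullbackCartier f D)) :
    f x ∉ stableBaseSet D := by
  obtain ⟨g, hg, hgx⟩ := notMem_baseLocus_iff.mp hx
  let : Algebra Y.functionField X.functionField := (functionFieldMap f).toAlgebra
  -- The minimal polynomial of `g` over `K(Y)` is the same at all points; only the scaling by `e` is
  -- local. Its coefficients are therefore global sections of multiples of `D`.
  have hcoeff (y : Y) (e : (Y.functionField)ˣ) (he : QuotientGroup.mk e = germAt D y) :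
      ∃ p : Polynomial (Y.presheaf.stalk y), p.Monic ∧
        p.natDegree = (minpoly Y.functionField g).natDegree ∧
        p.eval₂ ((functionFieldMap f).comp (algebraMap (Y.presheaf.stalk y) Y.functionField))
          (functionFieldMap f e * g) = 0 ∧
        ∀ i, algebraMap (Y.presheaf.stalk y) Y.functionField (p.coeff i) =
          (minpoly Y.functionField g).coeff i *
            (e : Y.functionField) ^ ((minpoly Y.functionField g).natDegree - i) := by
    let : Algebra (Y.presheaf.stalk y) X.functionField :=
      ((functionFieldMap f).comp (algebraMap (Y.presheaf.stalk y) Y.functionField)).toAlgebra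
    have : IsScalarTower (Y.presheaf.stalk y) Y.functionField X.functionField :=
      .of_algebraMap_eq fun _ ↦ rfl
    have := IsNormalScheme.isIntegrallyClosed_stalk y
    exact exists_monic_coeff_eq_scaleRoots e.ne_zero (isIntegralElem_of_mem_globalSections f hg he)
  set n := (minpoly Y.functionField g).natDegree with hn
  obtain ⟨e, he⟩ := exists_mk_eq_germAt D (f x)
  obtain ⟨p, hp, hpn, hpe, hpc⟩ := hcoeff (f x) e he
  obtain ⟨u, hu, hug⟩ := (isNonvanishingAt_iff _ _ _ _
    (mk_map_eq_germAt_pullbackCartier f he)).mp hgx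
  have hroot : p.eval₂ (f.stalkMap x).hom u = 0 := by
    apply IsFractionRing.injective (X.presheaf.stalk x) X.functionField
    rw [Polynomial.hom_eval₂, map_zero, hug, ← hpe]
    congr 1
    ext a
    exact (functionFieldMap_algebraMap f x a).symm
  obtain ⟨i, hi, hunit⟩ := exists_isUnit_coeff_of_isUnit_root (f.stalkMap x).hom hp hu hroot
  rw [hpn] at hi
  -- The coefficient of `Tⁱ` is scaled by `e ^ (n - i)`, so it is a section of `(n - i) • D`; this
  -- multiple is positive because `i < n`.
  refine notMem_stableBaseSet_iff.mpr ⟨n - i, Nat.sub_pos_of_lt hi,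
    notMem_baseLocus_iff.mpr ⟨(minpoly Y.functionField g).coeff i, fun y ↦ ?_, ?_⟩⟩
  · obtain ⟨e', he'⟩ := exists_mk_eq_germAt D y
    obtain ⟨p', -, -, -, hpc'⟩ := hcoeff y e' he'
    exact ⟨e' ^ (n - i), p'.coeff i, mk_eq_germAt_nsmul he' _, by
      rw [hpc', mul_comm, Units.val_pow_eq_pow_val]⟩
  · exact ⟨e ^ (n - i), p.coeff i, mk_eq_germAt_nsmul he _, hunit, by
      rw [hpc, mul_comm, Units.val_pow_eq_pow_val]⟩

theorem mem_stableBaseSet_pullback_iff [IsIntegralHom f] [IsNormalScheme Y]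
    {L : CartierDivisor Y} {x : X} :
    x ∈ stableBaseSet (pullbackCartier f L) ↔ f x ∈ stableBaseSet L := by
  refine not_iff_not.mp ⟨fun h ↦ ?_, notMem_stableBaseSet_pullback f⟩
  obtain ⟨m, hm, hmx⟩ := notMem_stableBaseSet_iff.mp h
  rw [← map_nsmul] at hmx
  rw [← stableBaseSet_nsmul L hm]
  exact notMem_stableBaseSet_of_notMem_baseLocus_pullback f hmx

end Finite

/-! ### Reduced preimages and very ample divisors -/

/-- Both sides are radical ideal sheaves, so comparing their supports pointwise is enough. -/
theorem vanishingIdeal_eq_reducedPreimage {X Y : Scheme.{u}} (f : X ⟶ Y) {Z : Closeds X}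
    {W : Closeds Y} (h : ∀ x, x ∈ Z ↔ f x ∈ W) :
    Scheme.IdealSheafData.vanishingIdeal Z =
      reducedPreimage f (Scheme.IdealSheafData.vanishingIdeal W) := by
  have hZ : Z = ((Scheme.IdealSheafData.vanishingIdeal W).comap f).support := by
    rw [Scheme.IdealSheafData.support_comap,
      show (Scheme.IdealSheafData.vanishingIdeal W).support = W from
        Closeds.ext (Scheme.IdealSheafData.coe_support_vanishingIdeal W)]
    exact Closeds.ext (Set.ext h)
  rw [reducedPreimage, hZ, Scheme.IdealSheafData.vanishingIdeal_support]

/-- The variables generate the polynomial ring as an algebra over its degree zero part. -/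
theorem iSup_stdOpen (k : Type u) [Field k] (n : ℕ) : ⨆ j, stdOpen k n j = ⊤ := by
  refine Proj.iSup_basicOpen_eq_top' _ _ (fun j ↦ ⟨1, MvPolynomial.isHomogeneous_X k j⟩) ?_
  rw [eq_top_iff]
  intro p _
  have hp : p ∈ Algebra.adjoin k (Set.range (MvPolynomial.X : Fin (n + 1) → _)) := by
    rw [MvPolynomial.adjoin_range_X]
    trivial
  induction hp using Algebra.adjoin_induction with
  | mem q hq => exact Algebra.subset_adjoin hq
  | algebraMap c =>
    exact Subalgebra.algebraMap_mem _ (algebraMap k (polyGrading k n 0) c)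
  | add q r _ _ hq hr => exact add_mem (hq trivial) (hr trivial)
  | mul q r _ _ hq hr => exact mul_mem (hq trivial) (hr trivial)

/-- The sections `g j` have no common zero because the standard opens cover projective space. This
weaker property, unlike very ampleness, survives pullback along `f`. -/
theorem IsVeryAmple.notMem_stableBaseSet {k : Type u} [Field k] {X : Scheme.{u}} [IsIntegral X]
    {s : X ⟶ Spec (CommRingCat.of k)} {A : CartierDivisor X} (hA : IsVeryAmple k s A) (x : X) :
    x ∉ stableBaseSet A := by
  obtain ⟨n, i, -, -, g, hg, hloc, -⟩ := hA
  obtain ⟨j, hj⟩ := Opens.mem_iSup.mp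
    (show i x ∈ ⨆ j, stdOpen k n j from (iSup_stdOpen k n).ge trivial)
  refine notMem_stableBaseSet_of_notMem_baseLocus (notMem_baseLocus_iff.mpr ⟨g j, hg j, ?_⟩)
  exact (hloc j).ge hj

/-! ### Real linear equivalence -/

section RealDivisors

variable {X Y : Scheme.{u}} [IsIntegral X] [IsIntegral Y]

theorem RLinearEquiv.symm {D E : RDivisor X} (h : RLinearEquiv D E) : RLinearEquiv E D := by
  unfold RLinearEquiv
  rw [← neg_sub]
  exact neg_mem h

theorem RLinearEquiv.trans {D E F : RDivisor X} (h : RLinearEquiv D E)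
    (h' : RLinearEquiv E F) : RLinearEquiv D F := by
  unfold RLinearEquiv
  rw [← sub_add_sub_cancel D E F]
  exact add_mem h h'

theorem RLinearEquiv.pullback (f : X ⟶ Y) [IsDominant f] {D E : RDivisor Y}
    (h : RLinearEquiv D E) : RLinearEquiv (pullbackR f D) (pullbackR f E) := by
  unfold RLinearEquiv
  rw [← map_sub]
  have h1 := Submodule.mem_map_of_mem (f := pullbackR f) h
  rw [Submodule.map_span] at h1
  refine Submodule.span_mono ?_ h1
  rintro _ ⟨_, ⟨g, rfl⟩, rfl⟩
  exact ⟨_, rfl⟩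

theorem pullbackR_sum_tmul (f : X ⟶ Y) [IsDominant f] {ι : Type*} [Fintype ι] (t : ι → ℝ)
    (B : ι → CartierDivisor Y) :
    pullbackR f (∑ i, t i ⊗ₜ[ℤ] B i) = ∑ i, t i ⊗ₜ[ℤ] pullbackCartier f (B i) := by
  rw [map_sum]
  rfl

end RealDivisors

end BaseLoci

end

theorem theorem1p1 (k : Type u) [Field k] [PerfectField k] (X Y : Scheme.{u})
    (sX : X ⟶ Spec (CommRingCat.of k)) (sY : Y ⟶ Spec (CommRingCat.of k))
    [IsIntegral X] [IsIntegral Y] [BaseLoci.IsNormalScheme X] [BaseLoci.IsNormalScheme Y]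
    (hX : BaseLoci.IsProjectiveOver k X sX) (hY : BaseLoci.IsProjectiveOver k Y sY)
    (f : X ⟶ Y) (hf : f ≫ sY = sX) [IsFinite f] [Surjective f] :
    (∀ D : BaseLoci.QDivisor Y,
      BaseLoci.stableBaseLocus (BaseLoci.pullbackQ f D) =
        BaseLoci.reducedPreimage f (BaseLoci.stableBaseLocus D)) ∧
    (∀ (Δ : BaseLoci.RDivisor Y) (c : BaseLoci.AugmentedChoice k sY Δ)
      (c' : BaseLoci.AugmentedChoice k sX (BaseLoci.pullbackR f Δ)),
      BaseLoci.augmentedBaseLocus c' =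
        BaseLoci.reducedPreimage f (BaseLoci.augmentedBaseLocus c)) := by
  refine ⟨fun D ↦ BaseLoci.vanishingIdeal_eq_reducedPreimage f fun x ↦ ?_,
    fun Δ c c' ↦ BaseLoci.vanishingIdeal_eq_reducedPreimage f fun x ↦ ?_⟩
  · obtain ⟨b, hb, L, hL⟩ := BaseLoci.exists_nsmul_eq_one_tmul D
    have hL' : b • BaseLoci.pullbackQ f D = 1 ⊗ₜ[ℤ] BaseLoci.pullbackCartier f L := by
      rw [← map_nsmul, hL]
      rfl
    rw [BaseLoci.stableBaseSetQ_eq hb hL, BaseLoci.stableBaseSetQ_eq hb hL']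
    exact BaseLoci.mem_stableBaseSet_pullback_iff f
  · have hB (i) : x ∉ BaseLoci.stableBaseSet (BaseLoci.pullbackCartier f (c.B i)) :=
      BaseLoci.notMem_stableBaseSet_pullback f ((c.isVeryAmple i).notMem_stableBaseSet _)
    have hB' (i) : x ∉ BaseLoci.stableBaseSet (c'.B i) := (c'.isVeryAmple i).notMem_stableBaseSet _
    have hequiv : BaseLoci.RLinearEquiv (∑ i, c.t i ⊗ₜ[ℤ] BaseLoci.pullbackCartier f (c.B i))
        (∑ i, c'.t i ⊗ₜ[ℤ] c'.B i) := by
      rw [← BaseLoci.pullbackR_sum_tmul]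
      exact (c.equiv.pullback f).symm.trans c'.equiv
    -- The Cartier case of the first part, applied to each rounded divisor, moves the question to
    -- `X`.
    have hpull (m : ℕ) : f x ∈ BaseLoci.stableBaseSet (∑ i, ⌊(m : ℝ) * c.t i⌋ • c.B i - c.A) ↔
        x ∈ BaseLoci.stableBaseSet (∑ i, ⌊(m : ℝ) * c.t i⌋ • BaseLoci.pullbackCartier f (c.B i) -
          BaseLoci.pullbackCartier f c.A) := by
      rw [← BaseLoci.mem_stableBaseSet_pullback_iff f, map_sub, map_sum]
      simp only [map_zsmul]
    simp only [BaseLoci.mem_iInf_pos_closeds, hpull]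
    -- The two inclusions are independence of choices with the roles exchanged; the pulled-back
    -- `c.A` is ample because `f` is affine.
    constructor
    · intro h m hm
      by_contra hx
      obtain ⟨M, hM, hMx⟩ := BaseLoci.exists_notMem_stableBaseSet_floor c'.A
        (c.isAmple.pullback f) hB' hB hequiv.symm hm hx
      exact hMx (h M hM)
    · intro h m hm
      by_contra hx
      obtain ⟨M, hM, hMx⟩ := BaseLoci.exists_notMem_stableBaseSet_floor
        (BaseLoci.pullbackCartier f c.A) c'.isAmple hB hB' hequiv hm hx
      exact hMx (h M hM)
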